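/- **Theorem (Advantages of causal ordering).** Let $d\ge 1$ and let $g^*(\boldsymbol I)=\sum_{\boldsymbol k\in\mathbb N^d}a_{\boldsymbol k}I_1^{k_1}\cdots I_d^{k_d}$ be a real power series in $d$ variables, not all of whose coefficients vanish, that converges absolutely on $[-1,1]^d$. A ReLU network of depth $T\ge 1$ and width $w$ is a composition of $T$ affine maps, with the activation $t\mapsto\max(t,0)$ applied coordinatewise after each of the first $T-1$ of them, and with $w$ units in each of the $T-1$ hidden layers. Put $$B(T)=2\sum_{\boldsymbol k\in\mathbb N^d}|a_{\boldsymbol k}|\,\exp\!\left(-d\delta\left(e^{-1}T^{\frac1{2d}}-1\right)\right).$$ Then for every $T\ge 1$, every $\delta>0$ and every latent dimension $q\ge 1$ the following hold. 1. There is a ReLU network $f_L:\mathbb R^d\to\mathbb R$ of depth $T$ and width $d+4$ such that $|f_L(\boldsymbol I)-g^*(\boldsymbol I)|<B(T)$ for all $\boldsymbol I\in[-1+\delta,1-\delta]^d$. 2. There are ReLU networks $f_L:\mathbb R^d\to\mathbb R$, $f_V:\mathbb R^d\to\mathbb R^q$ and $h_L:\mathbb R^q\to\mathbb R$, each of depth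 $T$ and width $d+4$, such that $|f_L(\boldsymbol I)+h_L(f_V(\boldsymbol I))-g^*(\boldsymbol I)|<B(3T)$ for all $\boldsymbol I\in[-1+\delta,1-\delta]^d$. 3. The structured form $f_L+h_L\circ f_V$ is better than the single encoder: the guaranteed accuracy is strictly smaller, $B(3T)<B(T)$, and every ReLU network $\mathbb R^d\to\mathbb R$ of depth $T$ and width $d+4$ is itself of the form $f_L+h_L\circ f_V$ with ReLU networks $f_L,f_V,h_L$ as in 2, so that the structured form reaches every accuracy that a single encoder reaches. -/

import Mathlib

/-- `IsReLUNet w m n T f` says that `f : ℝᵐ → ℝⁿ` is computed by a fully connected feed-forward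
ReLU network of depth `T` and width `w`: `T` affine layers, with the ReLU activation
`t ↦ max t 0` applied coordinatewise after each of the first `T - 1` of them, and `w` units in
each of the `T - 1` hidden layers.  (Networks with at most `w` units per layer are included, by
setting the weights of superfluous units to zero.) -/
inductive IsReLUNet (w : ℕ) : (m n T : ℕ) → ((Fin m → ℝ) → (Fin n → ℝ)) → Prop
  | output {m n : ℕ} (W : Matrix (Fin n) (Fin m) ℝ) (b : Fin n → ℝ) :
      IsReLUNet w m n 1 (fun x => W.mulVec x + b)
  | hidden {m n T : ℕ} {f : (Fin w → ℝ) → (Fin n → ℝ)}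
      (W : Matrix (Fin w) (Fin m) ℝ) (b : Fin w → ℝ) (hf : IsReLUNet w w n T f) :
      IsReLUNet w m n (T + 1) (fun x => f (fun j => max ((W.mulVec x + b) j) 0))

/-- Real-valued functions computed by a ReLU network of depth `T` and width `w`. -/
def IsScalarReLUNet (w m T : ℕ) (f : (Fin m → ℝ) → ℝ) : Prop :=
  IsReLUNet w m 1 T (fun x _ => f x)

/-- The accuracy `2 · ∑ₖ |aₖ| · exp (-d δ (e⁻¹ T ^ (1 / (2 d)) - 1))`. -/
noncomputable def accuracyBound {d : ℕ} (a : (Fin d → ℕ) → ℝ) (δ : ℝ) (T : ℕ) : ℝ :=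
  2 * (∑' k, |a k|) *
    Real.exp (-((d : ℝ) * δ * ((Real.exp 1)⁻¹ * (T : ℝ) ^ (1 / (2 * (d : ℝ))) - 1)))

/-! A single network of depth `T` already attains the accuracy belonging to `3 * T`
(`exists_net_lt_accuracyBound`). All claims follow from this: the structured form may take its
second branch to be zero, and the accuracy strictly decreases in the depth
(`accuracyBound_three_mul_lt`).

To build the network, truncate the series at total degree `N`. On the shrunken cube the tail is at
most `A * (1 - δ) ^ (N + 1)`, where `A` is the sum of the absolute values of the coefficients. The
polynomial is evaluated by a register machine of width `d + 4`, one layer per step. Squares come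
from a folding recursion (`sq_sub_foldedSquare_mem`) and products from polarization. Monomials are
formed by a reversible chain of multiplications that restores its registers (`Reach.addChain`), and
Horner's scheme handles one distinguished variable (`exists_reach_hornerValue`).

With `m` folds per square the error is at most `A * (6 * N + 2) * (1 / 4) ^ m`. With `m = N + 2`
this is below `A * exp (-(N + 1))`, and counting monomials shows that the layers fit into depth `T`
(`layers_le_of_pow_lt`). When the exponent is too small for this count, an affine truncation
suffices. -/

/-- `HiddenLayers w m t n F`: the map `F : ℝᵐ → ℝⁿ` is computed by the first `t` hidden layers, of
width `w`, of a ReLU network (for `t = 0` it is the identity). -/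
inductive HiddenLayers (w m : ℕ) : (t n : ℕ) → ((Fin m → ℝ) → (Fin n → ℝ)) → Prop
  | id : HiddenLayers w m 0 m (fun x => x)
  | hidden {t n : ℕ} {F : (Fin m → ℝ) → (Fin n → ℝ)} (W : Matrix (Fin w) (Fin n) ℝ)
      (b : Fin w → ℝ) (hF : HiddenLayers w m t n F) :
      HiddenLayers w m (t + 1) w (fun x j => max ((W.mulVec (F x) + b) j) 0)

theorem HiddenLayers.continuous {w m t n : ℕ} {F : (Fin m → ℝ) → (Fin n → ℝ)}
    (h : HiddenLayers w m t n F) : Continuous F := by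
  induction h with
  | id => exact continuous_id
  | hidden W b _ ih =>
    refine continuous_pi fun j => Continuous.max ?_ continuous_const
    exact (continuous_apply j).comp ((Continuous.matrix_mulVec continuous_const ih).add
      continuous_const)

theorem HiddenLayers.isReLUNet_comp {w m t n p T : ℕ} {F : (Fin m → ℝ) → (Fin n → ℝ)}
    (h : HiddenLayers w m t n F) {f : (Fin n → ℝ) → (Fin p → ℝ)} (hf : IsReLUNet w n p T f) :
    IsReLUNet w m p (t + T) (fun x => f (F x)) := by
  induction h generalizing T with
  | id => simpa using hf
  | hidden W b _ ih =>
    have := ih (IsReLUNet.hidden W b hf)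
    rwa [← add_assoc, add_right_comm] at this

/-! ### Affine functions of a hidden layer -/

/-- The functions that agree on `K` with an affine function of the components of `F`. -/
def affineReadouts {m n : ℕ} (K : Set (Fin m → ℝ)) (F : (Fin m → ℝ) → (Fin n → ℝ)) :
    Submodule ℝ ((Fin m → ℝ) → ℝ) where
  carrier := {g | ∃ (c : Fin n → ℝ) (b : ℝ), ∀ x ∈ K, g x = c ⬝ᵥ F x + b}
  add_mem' := by
    rintro g g' ⟨c, b, h⟩ ⟨c', b', h'⟩
    refine ⟨c + c', b + b', fun x hx => ?_⟩
    rw [Pi.add_apply, h x hx, h' x hx, add_dotProduct]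
    ring
  zero_mem' := ⟨0, 0, fun x _ => by simp⟩
  smul_mem' := by
    rintro a g ⟨c, b, h⟩
    refine ⟨a • c, a * b, fun x hx => ?_⟩
    rw [Pi.smul_apply, h x hx, smul_dotProduct, smul_eq_mul, smul_eq_mul]
    ring

section Readouts

variable {m n : ℕ} {K : Set (Fin m → ℝ)} {F : (Fin m → ℝ) → (Fin n → ℝ)}

theorem const_mem_affineReadouts (b : ℝ) : (fun _ => b) ∈ affineReadouts K F :=
  ⟨0, b, fun x _ => by simp⟩

theorem component_mem_affineReadouts (j : Fin n) : (fun x => F x j) ∈ affineReadouts K F :=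
  ⟨Pi.single j 1, 0, fun x _ => by simp⟩

theorem affineReadouts_congr {g g' : (Fin m → ℝ) → ℝ} (hg : g ∈ affineReadouts K F)
    (h : ∀ x ∈ K, g' x = g x) : g' ∈ affineReadouts K F := by
  obtain ⟨c, b, hc⟩ := hg
  exact ⟨c, b, fun x hx => (h x hx).trans (hc x hx)⟩

theorem add_mem_affineReadouts {g g' : (Fin m → ℝ) → ℝ} (hg : g ∈ affineReadouts K F)
    (hg' : g' ∈ affineReadouts K F) : (fun x => g x + g' x) ∈ affineReadouts K F :=
  add_mem hg hg'

theorem const_mul_mem_affineReadouts {g : (Fin m → ℝ) → ℝ} (a : ℝ)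
    (hg : g ∈ affineReadouts K F) : (fun x => a * g x) ∈ affineReadouts K F :=
  Submodule.smul_mem _ a hg

/-- On a compact set a constant shift makes a readout nonnegative, so ReLU acts on it as the
identity. This is how values are carried through a layer. -/
theorem exists_shift_nonneg (hK : IsCompact K) (hF : Continuous F) {g : (Fin m → ℝ) → ℝ}
    (hg : g ∈ affineReadouts K F) : ∃ B : ℝ, ∀ x ∈ K, 0 ≤ g x + B := by
  obtain ⟨c, b, h⟩ := hg
  have hcont : Continuous fun x => c ⬝ᵥ F x + b :=
    (Continuous.dotProduct continuous_const hF).add continuous_const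
  obtain ⟨B, hB⟩ := (hK.image hcont).bddBelow
  refine ⟨-B, fun x hx => ?_⟩
  have := hB (Set.mem_image_of_mem _ hx)
  rw [h x hx]
  linarith

theorem HiddenLayers.exists_succ {w t : ℕ} (hF : HiddenLayers w m t n F)
    {g : Fin w → (Fin m → ℝ) → ℝ} (hg : ∀ j, g j ∈ affineReadouts K F) :
    ∃ F', HiddenLayers w m (t + 1) w F' ∧ ∀ x ∈ K, ∀ j, F' x j = max (g j x) 0 := by
  choose c b h using hg
  refine ⟨_, HiddenLayers.hidden (Matrix.of c) b hF, fun x hx j => ?_⟩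
  rw [h j x hx]
  rfl

end Readouts

/-! ### Registers, approximate squares and approximate products -/

/-- The hidden layers `F` hold, on `K`, all inputs `x i` with `i ≠ i₀` and the three registers
`o`, `c`, `s`. -/
structure Carries {d : ℕ} (K : Set (Fin d → ℝ)) (i₀ : Fin d) (t : ℕ) {n : ℕ}
    (F : (Fin d → ℝ) → (Fin n → ℝ)) (o c s : (Fin d → ℝ) → ℝ) : Prop where
  layers : HiddenLayers (d + 4) d t n F
  coord : ∀ i, i ≠ i₀ → (fun x : Fin d → ℝ => x i) ∈ affineReadouts K F
  fst : o ∈ affineReadouts K F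
  snd : c ∈ affineReadouts K F
  acc : s ∈ affineReadouts K F

/-- The register contents `o`, `c`, `s` can be produced by `t` hidden layers. -/
def Reach {d : ℕ} (K : Set (Fin d → ℝ)) (i₀ : Fin d) (t : ℕ) (o c s : (Fin d → ℝ) → ℝ) : Prop :=
  ∃ (n : ℕ) (F : (Fin d → ℝ) → (Fin n → ℝ)), Carries K i₀ t F o c s

/-- The function `w ↦ ∑ₖ 4⁻ᵏ (|wₖ| - 1/4)`, with `m` terms, where `w₀ = w` and
`wₖ₊₁ = 2 |wₖ| - 1`. It approximates `w ↦ w ^ 2` on `[-1, 1]`. -/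
noncomputable def foldedSquare : ℕ → ℝ → ℝ
  | 0, _ => 0
  | m + 1, w => |w| - 1 / 4 + foldedSquare m (2 * |w| - 1) / 4

/-- The approximation of `u * v` by a difference of two approximate squares. -/
noncomputable def approxMul (m : ℕ) (u v : ℝ) : ℝ :=
  foldedSquare m ((u + v) / 2) - foldedSquare m ((u - v) / 2)

/-- From `w ^ 2 = |w| - 1 / 4 + (2 * |w| - 1) ^ 2 / 4`, each fold divides the error by four. The
error is one-sided, so a difference of two such squares has error at most `(1 / 4) ^ m`, not twice
that. -/
theorem sq_sub_foldedSquare_mem (m : ℕ) {w : ℝ} (hw : |w| ≤ 1) :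
    0 ≤ w ^ 2 - foldedSquare m w ∧ w ^ 2 - foldedSquare m w ≤ (1 / 4) ^ m := by
  induction m generalizing w with
  | zero =>
    have : w ^ 2 ≤ 1 := (sq_le_one_iff_abs_le_one w).2 hw
    simp only [foldedSquare, pow_zero, sub_zero]
    exact ⟨sq_nonneg w, this⟩
  | succ m ih =>
    have h0 := abs_nonneg w
    have h := ih (w := 2 * |w| - 1) (abs_le.2 ⟨by linarith, by linarith⟩)
    have hs : w ^ 2 = |w| ^ 2 := (sq_abs w).symm
    rw [foldedSquare, pow_succ (1 / 4 : ℝ), hs]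
    constructor <;> nlinarith [h.1, h.2]

theorem abs_approxMul_sub_le (m : ℕ) {u v : ℝ} (hu : |u| ≤ 1) (hv : |v| ≤ 1) :
    |approxMul m u v - u * v| ≤ (1 / 4) ^ m := by
  obtain ⟨hu1, hu2⟩ := abs_le.1 hu
  obtain ⟨hv1, hv2⟩ := abs_le.1 hv
  have h1 := sq_sub_foldedSquare_mem m (w := (u + v) / 2) (abs_le.2 ⟨by linarith, by linarith⟩)
  have h2 := sq_sub_foldedSquare_mem m (w := (u - v) / 2) (abs_le.2 ⟨by linarith, by linarith⟩)
  have h3 : u * v = ((u + v) / 2) ^ 2 - ((u - v) / 2) ^ 2 := by ring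
  rw [approxMul, h3, abs_le]
  constructor <;> linarith [h1.1, h1.2, h2.1, h2.2]

section Machine

variable {d : ℕ} {K : Set (Fin d → ℝ)} {i₀ : Fin d} {t : ℕ} {o c s : (Fin d → ℝ) → ℝ}

/-- The width is used up exactly: `d - 1` inputs, three registers, and two units for the positive
and negative parts of `w`, whose sum is `|w|`. -/
theorem Carries.exists_succ (hK : IsCompact K) {n : ℕ} {F : (Fin d → ℝ) → (Fin n → ℝ)}
    (h : Carries K i₀ t F o c s) {w : (Fin d → ℝ) → ℝ} (hw : w ∈ affineReadouts K F) :
    ∃ (n' : ℕ) (F' : (Fin d → ℝ) → (Fin n' → ℝ)), Carries K i₀ (t + 1) F' o c s ∧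
      (fun x => |w x|) ∈ affineReadouts K F' := by
  -- Register `o` occupies the slot freed by the input `i₀`.
  let r : Fin d → (Fin d → ℝ) → ℝ := fun i => if i = i₀ then o else fun x => x i
  have hr : ∀ i, r i ∈ affineReadouts K F := by
    intro i
    by_cases hi : i = i₀
    · simpa [r, hi] using h.fst
    · simpa [r, hi] using h.coord i hi
  have hc := h.layers.continuous
  choose B hB using fun i => exists_shift_nonneg hK hc (hr i)
  obtain ⟨B1, hB1⟩ := exists_shift_nonneg hK hc h.snd
  obtain ⟨B2, hB2⟩ := exists_shift_nonneg hK hc h.acc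
  let g : Fin (d + 4) → (Fin d → ℝ) → ℝ :=
    Fin.append (fun i x => r i x + B i)
      ![fun x => c x + B1, fun x => s x + B2, w, fun x => (-1) * w x]
  have hg : ∀ j, g j ∈ affineReadouts K F := by
    intro j
    refine Fin.addCases (fun i => ?_) (fun i => ?_) j
    · simp only [g, Fin.append_left]
      exact add_mem_affineReadouts (hr i) (const_mem_affineReadouts _)
    · simp only [g, Fin.append_right]
      fin_cases i
      · exact add_mem_affineReadouts h.snd (const_mem_affineReadouts _)
      · exact add_mem_affineReadouts h.acc (const_mem_affineReadouts _)
      · exact hw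
      · exact const_mul_mem_affineReadouts _ hw
  obtain ⟨F', hF', hx⟩ := h.layers.exists_succ hg
  have hpos : ∀ (j : Fin (d + 4)) (q : (Fin d → ℝ) → ℝ) (b : ℝ), (∀ x, g j x = q x + b) →
      (∀ x ∈ K, 0 ≤ q x + b) → q ∈ affineReadouts K F' := by
    intro j q b hj hq
    refine affineReadouts_congr (add_mem_affineReadouts (component_mem_affineReadouts j)
      (const_mem_affineReadouts (-b))) fun x hxK => ?_
    rw [hx x hxK j, hj, max_eq_left (hq x hxK)]
    ring
  have hr' : ∀ i, r i ∈ affineReadouts K F' := fun i =>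
    hpos (Fin.castAdd 4 i) (r i) (B i) (fun x => by simp [g]) (hB i)
  refine ⟨_, F', ⟨hF', fun i hi => ?_, ?_, ?_, ?_⟩, ?_⟩
  · simpa [r, hi] using hr' i
  · simpa [r] using hr' i₀
  · exact hpos (Fin.natAdd d 0) c B1 (fun x => by simp [g]) hB1
  · exact hpos (Fin.natAdd d 1) s B2 (fun x => by simp [g]) hB2
  · refine affineReadouts_congr (add_mem_affineReadouts
      (component_mem_affineReadouts (Fin.natAdd d (2 : Fin 4)))
      (component_mem_affineReadouts (Fin.natAdd d (3 : Fin 4)))) fun x hxK => ?_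
    rw [hx x hxK, hx x hxK]
    simp only [g, Fin.append_right, Matrix.cons_val]
    rcases le_total 0 (w x) with hw0 | hw0
    · rw [abs_of_nonneg hw0, max_eq_left hw0, max_eq_right (by linarith)]
      ring
    · rw [abs_of_nonpos hw0, max_eq_right hw0, max_eq_left (by linarith)]
      ring

theorem Carries.reach_addSquare (hK : IsCompact K) {n : ℕ} {F : (Fin d → ℝ) → (Fin n → ℝ)}
    (h : Carries K i₀ t F o c s) {w : (Fin d → ℝ) → ℝ} (hw : w ∈ affineReadouts K F) (m : ℕ)
    (α : ℝ) : Reach K i₀ (t + m) (fun x => o x + α * foldedSquare m (w x)) c s := by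
  induction m generalizing t n o w α with
  | zero => exact ⟨n, F, by simpa [foldedSquare] using h⟩
  | succ m ih =>
    obtain ⟨n', F', h', ha⟩ := h.exists_succ hK hw
    have hsq : (fun x => o x + α * (|w x| + (-1 / 4))) ∈ affineReadouts K F' :=
      add_mem_affineReadouts h'.fst (const_mul_mem_affineReadouts α
        (add_mem_affineReadouts ha (const_mem_affineReadouts _)))
    have hf : (fun x => 2 * |w x| + (-1)) ∈ affineReadouts K F' :=
      add_mem_affineReadouts (const_mul_mem_affineReadouts 2 ha) (const_mem_affineReadouts _)
    have := ih ⟨h'.layers, h'.coord, hsq, h'.snd, h'.acc⟩ hf (α / 4)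
    convert this using 1
    · ring
    · funext x
      rw [foldedSquare]
      ring_nf

theorem Reach.swap (h : Reach K i₀ t o c s) : Reach K i₀ t c o s := by
  obtain ⟨n, F, h⟩ := h
  exact ⟨n, F, h.layers, h.coord, h.snd, h.fst, h.acc⟩

theorem Reach.mono {o' c' s' : (Fin d → ℝ) → ℝ} (h : Reach K i₀ t o c s)
    (hset : ∀ {n : ℕ} {F : (Fin d → ℝ) → (Fin n → ℝ)}, Carries K i₀ t F o c s →
      o' ∈ affineReadouts K F ∧ c' ∈ affineReadouts K F ∧ s' ∈ affineReadouts K F) :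
    Reach K i₀ t o' c' s' := by
  obtain ⟨n, F, h⟩ := h
  obtain ⟨h1, h2, h3⟩ := hset h
  exact ⟨n, F, h.layers, h.coord, h1, h2, h3⟩

theorem Reach.pad (hK : IsCompact K) (h : Reach K i₀ t o c s) {t' : ℕ} (ht : t ≤ t') :
    Reach K i₀ t' o c s := by
  induction t', ht using Nat.le_induction with
  | base => exact h
  | succ t' _ ih =>
    obtain ⟨n, F, h⟩ := ih
    obtain ⟨n', F', h', _⟩ := h.exists_succ hK (const_mem_affineReadouts 0)
    exact ⟨n', F', h'⟩

theorem Reach.exists_net (h : Reach K i₀ t o c s) :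
    ∃ f : (Fin d → ℝ) → ℝ, IsScalarReLUNet (d + 4) d (t + 1) f ∧ ∀ x ∈ K, f x = s x := by
  obtain ⟨n, F, h⟩ := h
  obtain ⟨v, b, hv⟩ := h.acc
  refine ⟨fun x => v ⬝ᵥ F x + b, ?_, fun x hx => (hv x hx).symm⟩
  have := h.layers.isReLUNet_comp
    (IsReLUNet.output (w := d + 4) (Matrix.of fun _ : Fin 1 => v) (fun _ => b))
  exact this

theorem reach_coordinates : Reach K i₀ 0 (fun x => x i₀) (fun _ => 0) (fun _ => 0) :=
  ⟨d, _, HiddenLayers.id, fun i _ => component_mem_affineReadouts i,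
    component_mem_affineReadouts i₀, const_mem_affineReadouts 0, const_mem_affineReadouts 0⟩

/-- The two squares of the polarization identity are added to `o` one after the other, `m` layers
each. Since `o` changes meanwhile, `u` and `v` must be readable whatever `o` holds. -/
theorem Reach.addMul (hK : IsCompact K) (h : Reach K i₀ t o c s) {u v : (Fin d → ℝ) → ℝ}
    (huv : ∀ {t n : ℕ} {F : (Fin d → ℝ) → (Fin n → ℝ)} {o : (Fin d → ℝ) → ℝ},
      Carries K i₀ t F o c s → u ∈ affineReadouts K F ∧ v ∈ affineReadouts K F)
    (m : ℕ) (α : ℝ) :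
    Reach K i₀ (t + 2 * m) (fun x => o x + α * approxMul m (u x) (v x)) c s := by
  have key : ∀ {t : ℕ} {o : (Fin d → ℝ) → ℝ} (β α : ℝ), Reach K i₀ t o c s →
      Reach K i₀ (t + m) (fun x => o x + α * foldedSquare m (1 / 2 * (u x + β * v x))) c s := by
    rintro t o β α ⟨n, F, h⟩
    obtain ⟨hu, hv⟩ := huv h
    exact h.reach_addSquare hK (const_mul_mem_affineReadouts _ (add_mem_affineReadouts hu
      (const_mul_mem_affineReadouts β hv))) m α
  have := key (-1) (-α) (key 1 α h)
  convert this using 1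
  · ring
  · funext x
    rw [approxMul, show (u x + v x) / 2 = 1 / 2 * (u x + 1 * v x) by ring,
      show (u x - v x) / 2 = 1 / 2 * (u x + -1 * v x) by ring]
    ring

/-! ### Reversible evaluation of monomials -/

/-- Repeated approximate multiplication of `c` by the inputs listed: in each step the register
`o`, scaled by `ε`, receives the product, and then the two registers change their roles. -/
noncomputable def chainValue (m : ℕ) (ε : ℝ) (x : Fin d → ℝ) : List (Fin d) → ℝ → ℝ → ℝ
  | [], _, c => c
  | i :: l, o, c => chainValue m ε x l c (ε * o + 2 * approxMul m (c / 2) (x i))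

/-- With two registers, overwriting would destroy the old `o`. Scaling it by `ε ≠ 0` keeps it
recoverable: once the final product has been added to `s`, each multiplication is undone in reverse
order. Computing and undoing cost `2 * m` layers each per factor. -/
theorem Reach.addChain (hK : IsCompact K) (m : ℕ) {ε : ℝ} (hε : ε ≠ 0) (α : ℝ)
    (l : List (Fin d)) (hl : ∀ i ∈ l, i ≠ i₀) (h : Reach K i₀ t o c s) :
    Reach K i₀ (t + 4 * m * l.length) o c
      (fun x => s x + α * chainValue m ε x l (o x) (c x)) := by
  induction l generalizing t o c with
  | nil =>
    refine h.mono fun h => ⟨h.fst, h.snd, ?_⟩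
    exact add_mem_affineReadouts h.acc (const_mul_mem_affineReadouts α h.snd)
  | cons i l ih =>
    have hi : i ≠ i₀ := hl i (by simp)
    have hmul : ∀ {t n : ℕ} {F : (Fin d → ℝ) → (Fin n → ℝ)} {o s : (Fin d → ℝ) → ℝ},
        Carries K i₀ t F o c s →
        (fun x => c x / 2) ∈ affineReadouts K F ∧ (fun x => x i) ∈ affineReadouts K F :=
      fun h => ⟨affineReadouts_congr (const_mul_mem_affineReadouts (1 / 2) h.snd)
        fun x _ => by ring, h.coord i hi⟩
    have h1 : Reach K i₀ t (fun x => ε * o x) c s :=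
      h.mono fun h => ⟨const_mul_mem_affineReadouts ε h.fst, h.snd, h.acc⟩
    have h2 := h1.addMul hK hmul m 2
    have h3 := (ih (fun j hj => hl j (by simp [hj])) h2.swap).swap
    -- The same approximate product is subtracted, so the undoing is exact; dividing by `ε` then
    -- recovers `o`.
    have h4 := (h3.addMul hK hmul m (-2)).mono (o' := o) (c' := c) fun h =>
      ⟨affineReadouts_congr (const_mul_mem_affineReadouts ε⁻¹ h.fst) fun x _ => by
        field_simp
        ring, h.snd, h.acc⟩
    convert h4 using 1
    · rw [List.length_cons]
      ring
    · rfl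

/-- Each factor adds at most `4 * (1 / 4) ^ m`: half from the leftover `ε * o` with `|o| ≤ 2`, half
from the product. Keeping the accumulated error below one maintains the bound 2 on the registers. -/
theorem abs_chainValue_sub_le (m : ℕ) {x : Fin d → ℝ} (hx : ∀ i, |x i| ≤ 1) (l : List (Fin d))
    {o c μ e : ℝ} (ho : |o| ≤ 2) (hμ : |μ| ≤ 1) (hc : |c - μ| ≤ e)
    (he : e + 4 * (1 / 4) ^ m * l.length ≤ 1) :
    |chainValue m ((1 / 4) ^ m) x l o c - μ * (l.map x).prod| ≤
      e + 4 * (1 / 4) ^ m * l.length := by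
  induction l generalizing o c μ e with
  | nil => simpa [chainValue] using hc
  | cons i l ih =>
    set η : ℝ := (1 / 4) ^ m with hη
    have hη0 : 0 < η := by positivity
    rw [List.length_cons, Nat.cast_succ] at he ⊢
    have hle : 0 ≤ η * l.length := by positivity
    have hc2 : |c| ≤ 2 := by
      have : c = (c - μ) + μ := by ring
      rw [this]
      refine (abs_add_le _ _).trans ?_
      linarith
    have hmul := abs_approxMul_sub_le m (u := c / 2) (v := x i)
      (by rw [abs_div, abs_two]; linarith) (hx i)
    have hstep : |η * o + 2 * approxMul m (c / 2) (x i) - μ * x i| ≤ e + 4 * η := by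
      have hsplit : η * o + 2 * approxMul m (c / 2) (x i) - μ * x i =
          η * o + 2 * (approxMul m (c / 2) (x i) - c / 2 * x i) + (c - μ) * x i := by ring
      have h1 : |η * o| ≤ η * 2 := by
        rw [abs_mul, abs_of_pos hη0]
        exact mul_le_mul_of_nonneg_left ho hη0.le
      have h2 : |2 * (approxMul m (c / 2) (x i) - c / 2 * x i)| ≤ 2 * η := by
        rw [abs_mul, abs_two]
        exact mul_le_mul_of_nonneg_left hmul zero_le_two
      have h3 : |(c - μ) * x i| ≤ e := by
        rw [abs_mul]
        exact (mul_le_of_le_one_right (abs_nonneg _) (hx i)).trans hc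
      rw [hsplit]
      refine (abs_add_le _ _).trans ?_
      have := abs_add_le (η * o) (2 * (approxMul m (c / 2) (x i) - c / 2 * x i))
      linarith
    have hμ' : |μ * x i| ≤ 1 := by
      rw [abs_mul]
      exact mul_le_one₀ hμ (abs_nonneg _) (hx i)
    have := ih hc2 hμ' hstep (by linarith)
    rw [chainValue, List.map_cons, List.prod_cons, ← mul_assoc]
    linarith

end Machine

theorem exists_list_prod_eq {d : ℕ} (k : Fin d → ℕ) (u : Finset (Fin d)) :
    ∃ l : List (Fin d), (∀ i ∈ l, i ∈ u) ∧ l.length = ∑ i ∈ u, k i ∧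
      ∀ x : Fin d → ℝ, (l.map x).prod = ∏ i ∈ u, x i ^ k i := by
  classical
  induction u using Finset.induction_on with
  | empty => exact ⟨[], by simp⟩
  | insert j u hj ih =>
    obtain ⟨l, hl, hlen, hprod⟩ := ih
    refine ⟨List.replicate (k j) j ++ l, fun i hi => ?_, ?_, fun x => ?_⟩
    · rcases List.mem_append.1 hi with hi | hi
      · simp [List.eq_of_mem_replicate hi]
      · exact Finset.mem_insert_of_mem (hl i hi)
    · simp [Finset.sum_insert hj, hlen]
    · simp [Finset.prod_insert hj, hprod]

/-! ### Horner's scheme in one variable -/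

section Horner

variable {d : ℕ} {K : Set (Fin d → ℝ)} {i₀ : Fin d} {t : ℕ}

theorem Reach.addMonomials (hK : IsCompact K) (hK1 : ∀ x ∈ K, ∀ i, |x i| ≤ 1) (m N : ℕ)
    (hm : 4 * (1 / 4 : ℝ) ^ m * N ≤ 1) (a : (Fin d → ℕ) → ℝ) (f : Finset (Fin d → ℕ))
    (hf : ∀ k ∈ f, ∑ i ∈ Finset.univ.erase i₀, k i ≤ N) {c s : (Fin d → ℝ) → ℝ}
    (h : Reach K i₀ t (fun x => x i₀) c s) :
    ∃ c' s' : (Fin d → ℝ) → ℝ,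
      Reach K i₀ (t + 4 * m * ∑ k ∈ f, ∑ i ∈ Finset.univ.erase i₀, k i)
        (fun x => x i₀) c' s' ∧
      ∀ x ∈ K, |s' x - (s x + ∑ k ∈ f, a k * ∏ i ∈ Finset.univ.erase i₀, x i ^ k i)| ≤
        (∑ k ∈ f, |a k|) * (4 * (1 / 4) ^ m * N) := by
  classical
  induction f using Finset.induction_on with
  | empty => exact ⟨c, s, by simpa using h, by simp⟩
  | insert k f hk ih =>
    obtain ⟨c₁, s₁, h₁, hs₁⟩ := ih fun k' hk' => hf k' (Finset.mem_insert_of_mem hk')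
    obtain ⟨l, hl, hlen, hprod⟩ := exists_list_prod_eq k (Finset.univ.erase i₀)
    have h₂ : Reach K i₀ _ (fun x => x i₀) (fun _ => 1) s₁ :=
      h₁.mono fun h => ⟨h.fst, const_mem_affineReadouts 1, h.acc⟩
    have h₃ := h₂.addChain hK m (ε := (1 / 4) ^ m) (by positivity) (a k) l
      (fun i hi => Finset.ne_of_mem_erase (hl i hi))
    refine ⟨fun _ => 1, fun x => s₁ x + a k * chainValue m ((1 / 4) ^ m) x l (x i₀) 1, ?_,
      fun x hx => ?_⟩
    · convert h₃ using 1
      rw [Finset.sum_insert hk, hlen]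
      ring
    · have hlN : (l.length : ℝ) ≤ N := by
        rw [hlen]
        exact_mod_cast hf k (Finset.mem_insert_self _ _)
      have hle : 4 * (1 / 4 : ℝ) ^ m * l.length ≤ 4 * (1 / 4) ^ m * N := by gcongr
      have hchain := abs_chainValue_sub_le m (hK1 x hx) l (o := x i₀) (c := 1) (μ := 1) (e := 0)
        ((hK1 x hx i₀).trans one_le_two) (by simp) (by simp) (by linarith)
      rw [zero_add, one_mul, hprod] at hchain
      have hmul : |a k * (chainValue m ((1 / 4) ^ m) x l (x i₀) 1 -
          ∏ i ∈ Finset.univ.erase i₀, x i ^ k i)| ≤ |a k| * (4 * (1 / 4) ^ m * N) := by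
        rw [abs_mul]
        exact mul_le_mul_of_nonneg_left (hchain.trans hle) (abs_nonneg _)
      have hsum := abs_add_le (s₁ x -
        (s x + ∑ k ∈ f, a k * ∏ i ∈ Finset.univ.erase i₀, x i ^ k i))
        (a k * (chainValue m ((1 / 4) ^ m) x l (x i₀) 1 -
          ∏ i ∈ Finset.univ.erase i₀, x i ^ k i))
      have := hs₁ x hx
      rw [Finset.sum_insert hk, Finset.sum_insert hk, add_mul]
      calc _ = _ := by congr 1; ring
        _ ≤ _ := hsum
        _ ≤ _ := by linarith

/-- Horner's scheme in the variable `x i₀`: the coefficient polynomials, which have the monomials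
in `f 0, f 1, …`, do not involve `x i₀`. -/
noncomputable def hornerValue (i₀ : Fin d) (a : (Fin d → ℕ) → ℝ) (f : ℕ → Finset (Fin d → ℕ))
    (x : Fin d → ℝ) : ℕ → ℝ
  | 0 => 0
  | n + 1 => hornerValue i₀ a f x n * x i₀ +
      ∑ k ∈ f n, a k * ∏ i ∈ Finset.univ.erase i₀, x i ^ k i

theorem hornerValue_eq (a : (Fin d → ℕ) → ℝ) (f : ℕ → Finset (Fin d → ℕ)) (x : Fin d → ℝ)
    (n : ℕ) : hornerValue i₀ a f x n = ∑ j ∈ Finset.range n, x i₀ ^ (n - 1 - j) *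
      ∑ k ∈ f j, a k * ∏ i ∈ Finset.univ.erase i₀, x i ^ k i := by
  induction n with
  | zero => rfl
  | succ n ih =>
    rw [hornerValue, ih, Finset.sum_range_succ, Finset.sum_mul]
    congr 1
    · refine Finset.sum_congr rfl fun j hj => ?_
      rw [show n + 1 - 1 - j = n - 1 - j + 1 by have := Finset.mem_range.1 hj; omega, pow_succ]
      ring
    · simp

theorem abs_hornerValue_le (a : (Fin d → ℕ) → ℝ) (f : ℕ → Finset (Fin d → ℕ)) {x : Fin d → ℝ}
    (hx : ∀ i, |x i| ≤ 1) (n : ℕ) :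
    |hornerValue i₀ a f x n| ≤ ∑ j ∈ Finset.range n, ∑ k ∈ f j, |a k| := by
  induction n with
  | zero => simp [hornerValue]
  | succ n ih =>
    rw [hornerValue, Finset.sum_range_succ]
    refine (abs_add_le _ _).trans (add_le_add ?_ ?_)
    · rw [abs_mul]
      exact (mul_le_of_le_one_right (abs_nonneg _) (hx i₀)).trans ih
    · refine (Finset.abs_sum_le_sum_abs _ _).trans (Finset.sum_le_sum fun k _ => ?_)
      rw [abs_mul, Finset.abs_prod]
      refine mul_le_of_le_one_right (abs_nonneg _) (Finset.prod_le_one (fun i _ => abs_nonneg _)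
        fun i _ => ?_)
      rw [abs_pow]
      exact pow_le_one₀ (abs_nonneg _) (hx i)

theorem exists_reach_hornerValue (hK : IsCompact K) (hK1 : ∀ x ∈ K, ∀ i, |x i| ≤ 1) (m N : ℕ)
    (hm : (6 * N + 2) * (1 / 4 : ℝ) ^ m ≤ 1) (a : (Fin d → ℕ) → ℝ)
    (f : ℕ → Finset (Fin d → ℕ))
    (hf : ∀ j, ∀ k ∈ f j, ∑ i ∈ Finset.univ.erase i₀, k i ≤ N) {A : ℝ} (hA : 0 < A)
    (hfA : ∑ j ∈ Finset.range (N + 1), ∑ k ∈ f j, |a k| ≤ A) {n : ℕ} (hn : n ≤ N + 1) :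
    ∃ c s : (Fin d → ℝ) → ℝ,
      Reach K i₀ (2 * m * n + 4 * m * ∑ j ∈ Finset.range n, ∑ k ∈ f j,
        ∑ i ∈ Finset.univ.erase i₀, k i) (fun x => x i₀) c s ∧
      ∀ x ∈ K, |s x - hornerValue i₀ a f x n| ≤ n * (2 * A * (1 / 4) ^ m) +
        (∑ j ∈ Finset.range n, ∑ k ∈ f j, |a k|) * (4 * (1 / 4) ^ m * N) := by
  have hη : 0 < (1 / 4 : ℝ) ^ m := by positivity
  induction n with
  | zero =>
    refine ⟨fun _ => 0, fun _ => 0, ?_, fun x _ => by simp [hornerValue]⟩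
    simpa using reach_coordinates (K := K) (i₀ := i₀)
  | succ n ih =>
    obtain ⟨c, s, h, hs⟩ := ih (by omega)
    have h₁ : Reach K i₀ _ (fun _ => 0) (fun x => x i₀) s :=
      h.mono fun h => ⟨const_mem_affineReadouts 0, h.fst, h.acc⟩
    -- The exact partial sum is bounded by `A` and its error by `A`, so dividing by `2 * A` brings
    -- the accumulator into the range of `approxMul`.
    have h₂ := h₁.addMul hK (u := fun x => (2 * A)⁻¹ * s x) (v := fun x => x i₀)
      (fun h => ⟨const_mul_mem_affineReadouts _ h.acc, h.snd⟩) m (2 * A)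
    have h₃ : Reach K i₀ _ (fun x => x i₀) (fun x => x i₀)
        (fun x => 0 + 2 * A * approxMul m ((2 * A)⁻¹ * s x) (x i₀)) :=
      h₂.mono fun h => ⟨h.snd, h.snd, h.fst⟩
    obtain ⟨c', s', h₄, hs'⟩ := h₃.addMonomials hK hK1 m N (by nlinarith) a (f n) (hf n)
    refine ⟨c', s', ?_, fun x hx => ?_⟩
    · convert h₄ using 1
      rw [Finset.sum_range_succ]
      ring
    · have hB : ∑ j ∈ Finset.range n, ∑ k ∈ f j, |a k| ≤ A :=
        (Finset.sum_le_sum_of_subset_of_nonneg (Finset.range_mono (by omega))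
          fun _ _ _ => Finset.sum_nonneg fun _ _ => abs_nonneg _).trans hfA
      have hH := (abs_hornerValue_le (i₀ := i₀) a f (hK1 x hx) n).trans hB
      have hnN : (n : ℝ) ≤ N := by exact_mod_cast Nat.le_of_succ_le_succ hn
      have hsx := hs x hx
      have herr : n * (2 * A * (1 / 4) ^ m) +
          (∑ j ∈ Finset.range n, ∑ k ∈ f j, |a k|) * (4 * (1 / 4) ^ m * N) ≤ A := by
        have e1 : n * (2 * A * (1 / 4) ^ m) ≤ N * (2 * A * (1 / 4) ^ m) := by gcongr
        have e2 : (∑ j ∈ Finset.range n, ∑ k ∈ f j, |a k|) * (4 * (1 / 4) ^ m * N) ≤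
          A * (4 * (1 / 4) ^ m * N) := by gcongr
        nlinarith
      have hs2 : |(2 * A)⁻¹ * s x| ≤ 1 := by
        rw [abs_mul, abs_of_pos (by positivity), inv_mul_le_one₀ (by positivity)]
        have := abs_add_le (s x - hornerValue i₀ a f x n) (hornerValue i₀ a f x n)
        rw [sub_add_cancel] at this
        linarith
      have hmul := abs_approxMul_sub_le m hs2 (hK1 x hx i₀)
      have hmul' : |2 * A * (approxMul m ((2 * A)⁻¹ * s x) (x i₀) -
          (2 * A)⁻¹ * s x * x i₀)| ≤ 2 * A * (1 / 4) ^ m := by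
        rw [abs_mul, abs_of_pos (by positivity : 0 < 2 * A)]
        gcongr
      have hx0 : |(s x - hornerValue i₀ a f x n) * x i₀| ≤
          |s x - hornerValue i₀ a f x n| := by
        rw [abs_mul]
        exact mul_le_of_le_one_right (abs_nonneg _) (hK1 x hx i₀)
      have hsx' := hs' x hx
      rw [hornerValue, Finset.sum_range_succ, add_mul, Nat.cast_succ]
      set L := ∑ k ∈ f n, a k * ∏ i ∈ Finset.univ.erase i₀, x i ^ k i
      set ap := approxMul m ((2 * A)⁻¹ * s x) (x i₀)
      have hsplit : s' x - (hornerValue i₀ a f x n * x i₀ + L) =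
          (s' x - (0 + 2 * A * ap + L)) + 2 * A * (ap - (2 * A)⁻¹ * s x * x i₀) +
            (s x - hornerValue i₀ a f x n) * x i₀ := by
        field_simp
        ring
      rw [hsplit]
      refine (abs_add_le _ _).trans ?_
      have := abs_add_le (s' x - (0 + 2 * A * ap + L))
        (2 * A * (ap - (2 * A)⁻¹ * s x * x i₀))
      linarith

/-- ReLU networks of width `d + 4` approximate polynomials of degree at most `N`. -/
theorem exists_net_polynomial (hK : IsCompact K) (hK1 : ∀ x ∈ K, ∀ i, |x i| ≤ 1) (i₀ : Fin d)
    (m N : ℕ) (hm : (6 * N + 2) * (1 / 4 : ℝ) ^ m ≤ 1) (a : (Fin d → ℕ) → ℝ)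
    (u : Finset (Fin d → ℕ)) (hu : ∀ k ∈ u, ∑ i, k i ≤ N) {A : ℝ} (hA : 0 < A)
    (huA : ∑ k ∈ u, |a k| ≤ A) {T : ℕ}
    (hT : 2 * m * (N + 1) + 4 * m * ∑ k ∈ u, ∑ i ∈ Finset.univ.erase i₀, k i + 1 ≤ T) :
    ∃ f : (Fin d → ℝ) → ℝ, IsScalarReLUNet (d + 4) d T f ∧
      ∀ x ∈ K, |f x - ∑ k ∈ u, a k * ∏ i, x i ^ k i| ≤ A * ((6 * N + 2) * (1 / 4) ^ m) := by
  classical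
  -- The highest powers of `x i₀` enter first: a monomial added at step `j` is afterwards multiplied
  -- by `x i₀` exactly `N - j` times.
  let f : ℕ → Finset (Fin d → ℕ) := fun j => u.filter fun k => N - k i₀ = j
  have hmaps : ∀ k ∈ u, N - k i₀ ∈ Finset.range (N + 1) := fun k _ =>
    Finset.mem_range.2 (by omega)
  have hkN : ∀ k ∈ u, k i₀ ≤ N := fun k hk =>
    (Finset.single_le_sum (f := k) (fun _ _ => Nat.zero_le _) (Finset.mem_univ i₀)).trans (hu k hk)
  have hsum : ∑ j ∈ Finset.range (N + 1), ∑ k ∈ f j, |a k| = ∑ k ∈ u, |a k| :=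
    Finset.sum_fiberwise_of_maps_to hmaps _
  have hcount : ∑ j ∈ Finset.range (N + 1), ∑ k ∈ f j, ∑ i ∈ Finset.univ.erase i₀, k i =
      ∑ k ∈ u, ∑ i ∈ Finset.univ.erase i₀, k i :=
    Finset.sum_fiberwise_of_maps_to hmaps _
  obtain ⟨c, s, h, hs⟩ := exists_reach_hornerValue (i₀ := i₀) hK hK1 m N hm a f
    (fun j k hk => (Finset.sum_le_sum_of_subset (Finset.erase_subset _ _)).trans
      (hu k (Finset.mem_filter.1 hk).1)) hA (hsum.le.trans huA) le_rfl
  rw [hcount] at h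
  obtain ⟨F, hF, hFs⟩ := (h.pad hK (t' := T - 1) (by omega)).exists_net
  rw [Nat.sub_add_cancel (by omega)] at hF
  refine ⟨F, hF, fun x hx => ?_⟩
  have hval : hornerValue i₀ a f x (N + 1) = ∑ k ∈ u, a k * ∏ i, x i ^ k i := by
    rw [hornerValue_eq, ← Finset.sum_fiberwise_of_maps_to hmaps]
    refine Finset.sum_congr rfl fun j _ => ?_
    rw [Finset.mul_sum]
    refine Finset.sum_congr rfl fun k hk => ?_
    obtain ⟨hk, hj⟩ := Finset.mem_filter.1 hk
    rw [← Finset.mul_prod_erase _ _ (Finset.mem_univ i₀),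
      show N + 1 - 1 - j = k i₀ by have := hkN k hk; omega]
    ring
  have := hs x hx
  rw [hFs x hx, ← hval]
  refine this.trans ?_
  rw [hsum]
  have : (∑ k ∈ u, |a k|) * (4 * (1 / 4 : ℝ) ^ m * N) ≤ A * (4 * (1 / 4) ^ m * N) := by gcongr
  push_cast
  linarith

end Horner

/-! ### Counting monomials and layers -/

/-- The multi-indices of total degree at most `N`. -/
noncomputable def degreeSimplex (d N : ℕ) : Finset (Fin d → ℕ) :=
  (Finset.finsuppAntidiag (Finset.univ : Finset (Option (Fin d))) N).image
    fun P i => P (some i)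

theorem mem_degreeSimplex {d N : ℕ} {k : Fin d → ℕ} : k ∈ degreeSimplex d N ↔ ∑ i, k i ≤ N := by
  simp only [degreeSimplex, Finset.mem_image, Finset.mem_finsuppAntidiag]
  constructor
  · rintro ⟨P, ⟨hP, _⟩, rfl⟩
    rw [Fintype.sum_option] at hP
    exact (Nat.le_add_left _ _).trans hP.le
  · intro h
    -- The extra coordinate `none` is a slack variable absorbing the missing degree.
    refine ⟨Finsupp.equivFunOnFinite.symm fun o => o.elim (N - ∑ i, k i) k, ⟨?_, by simp⟩, ?_⟩
    · rw [Fintype.sum_option]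
      simp only [Finsupp.equivFunOnFinite_symm_apply_apply, Option.elim]
      omega
    · funext i
      simp

theorem card_degreeSimplex_le (d N : ℕ) : (degreeSimplex d N).card ≤ (N + d).choose d := by
  refine Finset.card_image_le.trans ?_
  rw [Finset.card_finsuppAntidiag_nat_eq_choose, Finset.card_univ, Fintype.card_option,
    Fintype.card_fin, show d + 1 + N - 1 = N + d by omega, Nat.choose_symm_add]

theorem sum_degreeSimplex_apply_eq {d N : ℕ} (i j : Fin d) :
    ∑ k ∈ degreeSimplex d N, k i = ∑ k ∈ degreeSimplex d N, k j := by
  refine Finset.sum_equiv (Equiv.arrowCongr (Equiv.swap i j) (Equiv.refl ℕ)) (fun k => ?_)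
    fun k _ => ?_
  · rw [mem_degreeSimplex, mem_degreeSimplex]
    have : ∑ l, (Equiv.arrowCongr (Equiv.swap i j) (Equiv.refl ℕ)) k l = ∑ l, k l :=
      Equiv.sum_comp (Equiv.swap i j).symm k
    rw [this]
  · simp [Equiv.arrowCongr]

/-- By symmetry every coordinate contributes equally to the total degree, so leaving out the Horner
variable saves the fraction `1 / d`. -/
theorem mul_sum_degreeSimplex_erase_le {d : ℕ} (N : ℕ) (i₀ : Fin d) :
    d * ∑ k ∈ degreeSimplex d N, ∑ i ∈ Finset.univ.erase i₀, k i ≤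
      (d - 1) * (N * (N + d).choose d) := by
  have hall : d * ∑ k ∈ degreeSimplex d N, k i₀ = ∑ k ∈ degreeSimplex d N, ∑ i, k i := by
    rw [Finset.sum_comm, Finset.sum_congr rfl fun i _ => sum_degreeSimplex_apply_eq i i₀]
    simp
  have herase : ∑ k ∈ degreeSimplex d N, ∑ i ∈ Finset.univ.erase i₀, k i =
      (d - 1) * ∑ k ∈ degreeSimplex d N, k i₀ := by
    rw [Finset.sum_comm, Finset.sum_congr rfl fun i _ => sum_degreeSimplex_apply_eq i i₀]
    simp
  rw [herase, mul_left_comm, hall]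
  refine Nat.mul_le_mul_left _ ?_
  calc _ ≤ ∑ k ∈ degreeSimplex d N, N :=
        Finset.sum_le_sum fun k hk => mem_degreeSimplex.1 hk
    _ = (degreeSimplex d N).card * N := by simp
    _ ≤ _ := by
      rw [mul_comm]
      exact Nat.mul_le_mul_left _ (card_degreeSimplex_le d N)

/-- The factor 2 comes from the exponential series at `d`: its terms of index `d - 1` and `d` are
equal, so twice `d ^ d / d!` is at most `exp d`. -/
theorem two_mul_choose_le (N : ℕ) {d : ℕ} (hd : 1 ≤ d) :
    2 * ((N + d).choose d : ℝ) ≤ (Real.exp 1 * (1 + N / d)) ^ d := by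
  have hd0 : (0 : ℝ) < d := by exact_mod_cast hd
  have hfac : 2 * ((d : ℝ) ^ d / d.factorial) ≤ Real.exp 1 ^ d := by
    have h := Real.sum_le_exp_of_nonneg hd0.le (d + 1)
    obtain ⟨e, rfl⟩ := Nat.exists_eq_add_of_le' hd
    rw [Finset.sum_range_succ, Finset.sum_range_succ] at h
    have hlast : ((e + 1 : ℕ) : ℝ) ^ (e + 1) / ((e + 1).factorial : ℝ) =
        ((e + 1 : ℕ) : ℝ) ^ e / (e.factorial : ℝ) := by
      rw [Nat.factorial_succ, Nat.cast_mul, pow_succ, mul_comm (((e + 1 : ℕ) : ℝ) ^ e),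
        mul_div_mul_left _ _ hd0.ne']
    have hpos : 0 ≤ ∑ i ∈ Finset.range e, ((e + 1 : ℕ) : ℝ) ^ i / (i.factorial : ℝ) :=
      Finset.sum_nonneg fun i _ => by positivity
    rw [← Real.exp_nat_mul, mul_one]
    linarith
  have hch : ((N + d).choose d : ℝ) ≤ ((N + d : ℕ) : ℝ) ^ d / d.factorial :=
    Nat.choose_le_pow_div d (N + d)
  have hsplit : ((N + d : ℕ) : ℝ) = d * (1 + N / d) := by
    push_cast
    field_simp
    ring
  rw [hsplit, mul_pow] at hch
  rw [mul_pow]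
  have hpow : (0 : ℝ) ≤ (1 + N / d) ^ d := by positivity
  calc 2 * ((N + d).choose d : ℝ) ≤ 2 * (d ^ d * (1 + N / d) ^ d / d.factorial) := by linarith
    _ = 2 * ((d : ℝ) ^ d / d.factorial) * (1 + N / d) ^ d := by ring
    _ ≤ _ := mul_le_mul_of_nonneg_right hfac hpow

/-- Bernoulli's inequality with exponent `d / 3 ≥ 1`. -/
theorem pow_three_le_pow (N : ℕ) {d : ℕ} (hd : 3 ≤ d) :
    (Real.exp 1 * (1 + N / 3)) ^ 3 ≤ (Real.exp 1 * (1 + N / d)) ^ d := by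
  have hd0 : (0 : ℝ) < d := by exact_mod_cast (by omega : 0 < d)
  have hd3 : (3 : ℝ) ≤ d := by exact_mod_cast hd
  have h1 : 1 + (N : ℝ) / 3 ≤ (1 + (N : ℝ) / d) ^ ((d : ℝ) / 3) := by
    have := one_add_mul_self_le_rpow_one_add (s := (N : ℝ) / d) (p := d / 3)
      (by have : (0 : ℝ) ≤ N / d := by positivity
          linarith) (by linarith)
    refine le_trans (le_of_eq ?_) this
    field_simp
  have h2 : (1 + (N : ℝ) / 3) ^ 3 ≤ (1 + (N : ℝ) / d) ^ d := by
    calc (1 + (N : ℝ) / 3) ^ 3 ≤ ((1 + (N : ℝ) / d) ^ ((d : ℝ) / 3)) ^ 3 := by gcongr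
      _ = (1 + (N : ℝ) / d) ^ d := by
        rw [← Real.rpow_mul_natCast (by positivity)]
        push_cast
        rw [div_mul_cancel₀ _ three_ne_zero, Real.rpow_natCast]
  have h3 : Real.exp 1 ^ 3 ≤ Real.exp 1 ^ d :=
    pow_le_pow_right₀ (Real.one_le_exp zero_le_one) hd
  rw [mul_pow, mul_pow]
  exact mul_le_mul h3 h2 (by positivity) (by positivity)

/-- For `d ≥ 3`, with `Q` the `d`-th power, three times the cost is at most `Q + 6 * N * (N + 2) *
Q`, which is below `Q ^ 2`. For `d = 1` no chains are needed, and for `d = 2` the saving from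
Horner's scheme is used. -/
theorem layers_le_of_pow_lt {d N T W : ℕ} (hd : 1 ≤ d) (hN : 4 ≤ N)
    (hW : d * W ≤ (d - 1) * (N * (N + d).choose d))
    (hT : (Real.exp 1 * (1 + N / d)) ^ (2 * d) < 3 * T) :
    2 * (N + 2) * (N + 1) + 4 * (N + 2) * W + 1 ≤ T := by
  have he : (2.718 : ℝ) < Real.exp 1 := by linarith [Real.exp_one_gt_d9]
  have hN' : (4 : ℝ) ≤ N := by exact_mod_cast hN
  suffices h : (2 * (N + 2) * (N + 1) + 4 * (N + 2) * W : ℝ) < T by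
    have : 2 * (N + 2) * (N + 1) + 4 * (N + 2) * W < T := by exact_mod_cast h
    omega
  obtain rfl | rfl | hd3 : d = 1 ∨ d = 2 ∨ 3 ≤ d := by omega
  · have hW0 : W = 0 := by simpa using hW
    subst hW0
    have h : (2.718 * (1 + (N : ℝ))) ^ 2 ≤ (Real.exp 1 * (1 + N / (1 : ℕ))) ^ (2 * 1) := by
      rw [Nat.cast_one, div_one, mul_one]
      gcongr
    push_cast
    nlinarith
  · have hch : 2 * (N + 2).choose 2 = (N + 2) * (N + 1) := by
      rw [Nat.choose_two_right]
      exact Nat.mul_div_cancel' (Nat.even_mul_pred_self (N + 2)).two_dvd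
    have hW2 : 4 * W ≤ N * ((N + 2) * (N + 1)) := by
      rw [← hch]
      nlinarith
    have hW2' : (4 : ℝ) * W ≤ N * ((N + 2) * (N + 1)) := by exact_mod_cast hW2
    have h : (2.718 * (1 + (N : ℝ) / 2)) ^ 4 ≤
        (Real.exp 1 * (1 + N / (2 : ℕ))) ^ (2 * 2) := by
      norm_num only [Nat.cast_ofNat]
      gcongr
      linarith
    have h2 : (2.718 * (1 + (N : ℝ) / 2)) ^ 4 ≥ 3 * (N + 2) ^ 4 := by
      have : (2.718 * (1 + (N : ℝ) / 2)) ^ 4 = 1.359 ^ 4 * (N + 2) ^ 4 := by ring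
      rw [this]
      gcongr
      norm_num
    have h3 : (N + 2 : ℝ) ^ 4 ≤ T := by linarith
    have h4 : (N + 2) * (4 * W) ≤ (N + 2) * (N * ((N + 2) * (N + 1)) : ℝ) := by gcongr
    nlinarith
  · set Q : ℝ := (Real.exp 1 * (1 + N / d)) ^ d with hQ
    have hQ2 : Q ^ 2 < 3 * T := by
      rw [hQ, ← pow_mul, mul_comm d 2]
      exact hT
    have hP := two_mul_choose_le N hd
    have hWP : (W : ℝ) ≤ N * (N + d).choose d := by
      have hmul : d * W ≤ d * (N * (N + d).choose d) :=
        hW.trans (Nat.mul_le_mul_right _ (Nat.sub_le d 1))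
      exact_mod_cast Nat.le_of_mul_le_mul_left hmul (by omega)
    have hWQ : 2 * (W : ℝ) ≤ N * Q := by nlinarith
    have hQlow : 6 * (N + 1) * (N + 2) ≤ Q := by
      have h3 : (2.718 * (1 + (N : ℝ) / 3)) ^ 3 ≤ Q :=
        le_trans (by gcongr) (pow_three_le_pow N hd3)
      refine le_trans ?_ h3
      obtain ⟨y, hy⟩ : ∃ y : ℝ, (N : ℝ) = y + 4 := ⟨N - 4, by ring⟩
      have hy0 : 0 ≤ y := by linarith
      rw [hy]
      have h2 : 0 ≤ y ^ 2 := by positivity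
      have h3 : 0 ≤ y ^ 3 := by positivity
      linarith
    have h5 : (N + 2) * (2 * W) ≤ (N + 2) * (N * Q : ℝ) := by gcongr
    have hQ0 : 0 < Q := by positivity
    nlinarith

theorem degree_mul_exp_lt {N : ℕ} (hN : 4 ≤ N) :
    (6 * N + 2) * Real.exp (N + 1) < (4 : ℝ) ^ (N + 2) := by
  have he : Real.exp 1 < 2.7183 := by linarith [Real.exp_one_lt_d9]
  induction N, hN using Nat.le_induction with
  | base =>
    have : Real.exp ((4 : ℕ) + 1) = Real.exp 1 ^ 5 := by
      rw [← Real.exp_nat_mul]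
      norm_num
    rw [this]
    -- The start is tight: `26 * exp 5` is about 3859, against `4 ^ 6 = 4096`; the inequality fails
    -- for `N = 3`.
    have h5 : Real.exp 1 ^ 5 < 2.7183 ^ 5 := by gcongr
    norm_num at h5 ⊢
    linarith
  | succ N hN ih =>
    have hN' : (4 : ℝ) ≤ N := by exact_mod_cast hN
    rw [Nat.cast_succ, Real.exp_add, show N + 1 + 2 = N + 2 + 1 by ring, pow_succ]
    have hpos := Real.exp_pos ((N : ℝ) + 1)
    have : (6 * ((N : ℝ) + 1) + 2) * Real.exp 1 ≤ 4 * (6 * N + 2) := by nlinarith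
    nlinarith

/-! ### Affine truncation, tail of the series and conclusion -/

theorem isReLUNet_zero (w m n : ℕ) {T : ℕ} (hT : 1 ≤ T) :
    IsReLUNet w m n T (fun _ _ => 0) := by
  induction T, hT using Nat.le_induction generalizing m with
  | base =>
    convert IsReLUNet.output (w := w) (0 : Matrix (Fin n) (Fin m) ℝ) 0 using 1
    funext x j
    simp
  | succ T _ ih => exact IsReLUNet.hidden 0 0 (ih w)

theorem monomial_mem_affineReadouts {d n : ℕ} {K : Set (Fin d → ℝ)}
    {F : (Fin d → ℝ) → (Fin n → ℝ)}
    (hF : ∀ i, (fun x : Fin d → ℝ => x i) ∈ affineReadouts K F) {k : Fin d → ℕ}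
    (hk : ∑ i, k i ≤ 1) : (fun x : Fin d → ℝ => ∏ i, x i ^ k i) ∈ affineReadouts K F := by
  by_cases h : ∀ i, k i = 0
  · simpa [h] using const_mem_affineReadouts (K := K) (F := F) 1
  · push Not at h
    obtain ⟨j, hj⟩ := h
    have hsum := Finset.add_sum_erase Finset.univ k (Finset.mem_univ j)
    have hj1 : k j = 1 := by omega
    have h0 : ∀ i ∈ Finset.univ.erase j, k i = 0 := Finset.sum_eq_zero_iff.1 (by omega)
    convert hF j using 2 with x
    rw [← Finset.mul_prod_erase _ _ (Finset.mem_univ j), hj1, pow_one,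
      Finset.prod_eq_one fun i hi => by rw [h0 i hi, pow_zero], mul_one]

theorem exists_net_of_degree_le_one {d : ℕ} {K : Set (Fin d → ℝ)} (hK : IsCompact K)
    (i₀ : Fin d) (a : (Fin d → ℕ) → ℝ) {T : ℕ} (hT : 1 ≤ T) :
    ∃ f : (Fin d → ℝ) → ℝ, IsScalarReLUNet (d + 4) d T f ∧
      ∀ x ∈ K, f x = ∑ k ∈ degreeSimplex d 1, a k * ∏ i, x i ^ k i := by
  have h : Reach K i₀ 0 (fun x => x i₀) (fun _ => 0)
      (fun x => ∑ k ∈ degreeSimplex d 1, a k * ∏ i, x i ^ k i) := by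
    refine reach_coordinates.mono fun h => ⟨h.fst, h.snd, ?_⟩
    have hc : ∀ i, (fun x : Fin d → ℝ => x i) ∈ affineReadouts K _ := fun i => by
      by_cases hi : i = i₀
      · exact hi ▸ h.fst
      · exact h.coord i hi
    convert Submodule.sum_mem (affineReadouts K _) fun k hk =>
      const_mul_mem_affineReadouts (a k)
        (monomial_mem_affineReadouts hc (mem_degreeSimplex (N := 1).1 hk)) using 1
    funext x
    simp
  have := (h.pad hK (Nat.zero_le (T - 1))).exists_net
  rwa [Nat.sub_add_cancel hT] at this

theorem abs_sub_truncation_le {d : ℕ} {a : (Fin d → ℕ) → ℝ} (ha : Summable fun k => |a k|)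
    {x : Fin d → ℝ} {y ρ : ℝ} (hy : HasSum (fun k : Fin d → ℕ => a k * ∏ i, x i ^ k i) y)
    (hρ1 : ρ ≤ 1) (hx : ∀ i, |x i| ≤ ρ) (hρ0 : 0 ≤ ρ) (N : ℕ) :
    |y - ∑ k ∈ degreeSimplex d N, a k * ∏ i, x i ^ k i| ≤ (∑' k, |a k|) * ρ ^ (N + 1) := by
  classical
  have hs := hy.sub (hasSum_sum_of_ne_finset_zero (s := degreeSimplex d N)
    (f := fun k => if k ∈ degreeSimplex d N then a k * ∏ i, x i ^ k i else 0)
    fun k hk => if_neg hk)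
  rw [Finset.sum_congr rfl fun k hk => if_pos hk] at hs
  refine hs.norm_le_of_bounded (ha.hasSum.mul_right (ρ ^ (N + 1))) fun k => ?_
  split_ifs with hk
  · simpa using by positivity
  · rw [sub_zero, Real.norm_eq_abs, abs_mul, Finset.abs_prod]
    refine mul_le_mul_of_nonneg_left ?_ (abs_nonneg _)
    calc ∏ i, |x i ^ k i| ≤ ∏ i, ρ ^ k i := by
          refine Finset.prod_le_prod (fun i _ => abs_nonneg _) fun i _ => ?_
          rw [abs_pow]
          exact pow_le_pow_left₀ (abs_nonneg _) (hx i) _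
      _ = ρ ^ ∑ i, k i := Finset.prod_pow_eq_pow_sum _ _ _
      _ ≤ ρ ^ (N + 1) := by
        refine pow_le_pow_of_le_one hρ0 hρ1 ?_
        rw [mem_degreeSimplex] at hk
        omega

/-- The tangent bound `2 * (1 - δ) ≤ exp (1 - 2 * δ)`, squared, gives the claim because `exp 2 < 8`.
It makes degree one sufficient whenever `M ≤ 4`. -/
theorem one_sub_sq_lt {δ M : ℝ} (hδ0 : 0 ≤ δ) (hδ1 : δ ≤ 1) (hM : M ≤ 4) :
    (1 - δ) ^ 2 < 2 * Real.exp (-(δ * M)) := by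
  have h1 : 2 * (1 - δ) ≤ Real.exp (1 - 2 * δ) := by
    have := Real.add_one_le_exp (1 - 2 * δ)
    linarith
  have h2 : (2 * (1 - δ)) ^ 2 ≤ Real.exp (1 - 2 * δ) ^ 2 := by
    have : 0 ≤ 1 - δ := by linarith
    gcongr
  have h3 : Real.exp (1 - 2 * δ) ^ 2 = Real.exp 1 ^ 2 * Real.exp (-(δ * 4)) := by
    rw [← Real.exp_nat_mul, ← Real.exp_nat_mul, ← Real.exp_add]
    congr 1
    push_cast
    ring
  have h4 : Real.exp (-(δ * 4)) ≤ Real.exp (-(δ * M)) := by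
    apply Real.exp_le_exp.2
    nlinarith
  have h5 : Real.exp 1 ^ 2 < 8 := by
    have := Real.exp_one_lt_d9
    have := Real.exp_pos 1
    nlinarith
  have := Real.exp_pos (-(δ * 4))
  nlinarith

theorem exists_net_lt_accuracyBound {d : ℕ} (hd : 1 ≤ d) {a : (Fin d → ℕ) → ℝ}
    (ha : Summable fun k => |a k|) (hA : 0 < ∑' k, |a k|) {g : (Fin d → ℝ) → ℝ}
    (hg : ∀ x : Fin d → ℝ, (∀ i, x i ∈ Set.Icc (-1 : ℝ) 1) →
      HasSum (fun k : Fin d → ℕ => a k * ∏ i, x i ^ k i) (g x))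
    {T : ℕ} (hT : 1 ≤ T) {δ : ℝ} (hδ : 0 < δ) :
    ∃ f : (Fin d → ℝ) → ℝ, IsScalarReLUNet (d + 4) d T f ∧
      ∀ x : Fin d → ℝ, (∀ i, x i ∈ Set.Icc (-1 + δ) (1 - δ)) →
        |f x - g x| < accuracyBound a δ (3 * T) := by
  set A := ∑' k, |a k| with hAdef
  let i₀ : Fin d := ⟨0, hd⟩
  have hd0 : (0 : ℝ) < d := by exact_mod_cast hd
  have hK : IsCompact (Set.Icc (-1) 1 : Set (Fin d → ℝ)) := isCompact_Icc
  have hK1 : ∀ x ∈ (Set.Icc (-1) 1 : Set (Fin d → ℝ)), ∀ i, |x i| ≤ 1 := fun x hx i =>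
    abs_le.2 ⟨hx.1 i, hx.2 i⟩
  have hbox : ∀ x : Fin d → ℝ, (∀ i, x i ∈ Set.Icc (-1 + δ) (1 - δ)) → δ ≤ 1 ∧
      x ∈ (Set.Icc (-1) 1 : Set (Fin d → ℝ)) ∧ ∀ N : ℕ,
      |g x - ∑ k ∈ degreeSimplex d N, a k * ∏ i, x i ^ k i| ≤ A * (1 - δ) ^ (N + 1) := by
    intro x hx
    have hδ1 : δ ≤ 1 := by linarith [(hx i₀).1, (hx i₀).2]
    have hx1 : ∀ i, x i ∈ Set.Icc (-1 : ℝ) 1 := fun i =>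
      ⟨by linarith [(hx i).1], by linarith [(hx i).2]⟩
    exact ⟨hδ1, ⟨fun i => (hx1 i).1, fun i => (hx1 i).2⟩, fun N =>
      abs_sub_truncation_le ha (hg x hx1) (by linarith)
        (fun i => abs_le.2 ⟨by linarith [(hx i).1], (hx i).2⟩) (by linarith) N⟩
  set M : ℝ := d * ((Real.exp 1)⁻¹ * ((3 * T : ℕ) : ℝ) ^ (1 / (2 * (d : ℝ))) - 1) with hM
  have hacc : accuracyBound a δ (3 * T) = 2 * A * Real.exp (-(δ * M)) := by
    rw [accuracyBound, ← hAdef, hM, mul_assoc (d : ℝ) δ, mul_left_comm δ]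
  rw [hacc]
  rcases le_or_gt M 4 with hM4 | hM4
  · obtain ⟨f, hf, hfx⟩ := exists_net_of_degree_le_one hK i₀ a hT
    refine ⟨f, hf, fun x hx => ?_⟩
    obtain ⟨hδ1, hxK, htail⟩ := hbox x hx
    rw [hfx x hxK, abs_sub_comm]
    refine (htail 1).trans_lt ?_
    rw [one_add_one_eq_two]
    linarith [mul_lt_mul_of_pos_left (one_sub_sq_lt hδ.le hδ1 hM4) hA]
  -- The choice `N < M ≤ N + 1` serves both ends: the lower bound on `M` pays for the layers, the
  -- upper one makes tail and network error each at most `A * exp (-(δ * M))`. The two errors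
  -- account for the factor 2 in the accuracy.
  · obtain ⟨N, hN⟩ : ∃ N, ⌈M⌉₊ = N + 1 :=
      Nat.exists_eq_succ_of_ne_zero (Nat.ceil_pos.2 (by linarith)).ne'
    have hMN : M ≤ N + 1 := by
      have := Nat.le_ceil M
      rw [hN] at this
      exact_mod_cast this
    have hNM : (N : ℝ) < M := Nat.lt_ceil.1 (by omega)
    have hN4 : 4 ≤ N := by
      have : (3 : ℝ) < N := by linarith
      exact_mod_cast this
    have hpow : (Real.exp 1 * (1 + N / d)) ^ (2 * d) < 3 * T := by
      have h1 : 1 + (N : ℝ) / d < (Real.exp 1)⁻¹ * ((3 * T : ℕ) : ℝ) ^ (1 / (2 * (d : ℝ))) := by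
        rw [hM, ← div_lt_iff₀' hd0] at hNM
        linarith
      rw [lt_inv_mul_iff₀ (Real.exp_pos 1)] at h1
      calc _ < (((3 * T : ℕ) : ℝ) ^ (1 / (2 * (d : ℝ)))) ^ (2 * d) :=
            pow_lt_pow_left₀ h1 (by positivity) (by omega)
        _ = 3 * T := by
          rw [← Real.rpow_mul_natCast (by positivity)]
          push_cast
          rw [one_div_mul_cancel (by positivity), Real.rpow_one]
    have hdeg := degree_mul_exp_lt hN4
    have hexp := Real.one_le_exp (x := (N : ℝ) + 1) (by positivity)
    have hnet : (6 * N + 2) * (1 / 4 : ℝ) ^ (N + 2) < Real.exp (-(N + 1)) := by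
      rw [one_div, inv_pow, ← div_eq_mul_inv, Real.exp_neg, div_lt_iff₀ (by positivity),
        inv_mul_eq_div, lt_div_iff₀ (Real.exp_pos _)]
      exact hdeg
    obtain ⟨f, hf, hfx⟩ := exists_net_polynomial hK hK1 i₀ (N + 2) N
      (hnet.le.trans (Real.exp_le_one_iff.2 (by have := N.cast_nonneg (α := ℝ); linarith))) a
      (degreeSimplex d N) (fun k hk => mem_degreeSimplex.1 hk) hA
      (ha.sum_le_tsum _ fun _ _ => abs_nonneg _)
      (layers_le_of_pow_lt hd hN4 (mul_sum_degreeSimplex_erase_le N i₀) hpow)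
    refine ⟨f, hf, fun x hx => ?_⟩
    obtain ⟨hδ1, hxK, htail⟩ := hbox x hx
    have h1 := hfx x hxK
    have h2 := htail N
    rw [abs_sub_comm] at h2
    have h3 := abs_sub_le (f x) (∑ k ∈ degreeSimplex d N, a k * ∏ i, x i ^ k i) (g x)
    have h4 : (1 - δ) ^ (N + 1) ≤ Real.exp (-(δ * M)) := by
      calc (1 - δ) ^ (N + 1) ≤ Real.exp (-δ) ^ (N + 1) :=
            pow_le_pow_left₀ (by linarith) (Real.one_sub_le_exp_neg δ) _
        _ = Real.exp (-(δ * (N + 1))) := by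
          rw [← Real.exp_nat_mul]
          congr 1
          push_cast
          ring
        _ ≤ _ := Real.exp_le_exp.2 (by nlinarith)
    have h5 : Real.exp (-(N + 1)) ≤ Real.exp (-(δ * M)) := Real.exp_le_exp.2 (by nlinarith)
    have h6 := mul_lt_mul_of_pos_left (hnet.trans_le h5) hA
    have h7 := mul_le_mul_of_nonneg_left h4 hA.le
    linarith

theorem accuracyBound_three_mul_lt {d : ℕ} (hd : 1 ≤ d) {a : (Fin d → ℕ) → ℝ}
    (hA : 0 < ∑' k, |a k|) {T : ℕ} (hT : 1 ≤ T) {δ : ℝ} (hδ : 0 < δ) :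
    accuracyBound a δ (3 * T) < accuracyBound a δ T := by
  have hd0 : (0 : ℝ) < d := by exact_mod_cast hd
  have hT0 : (0 : ℝ) < T := by exact_mod_cast hT
  have h : (T : ℝ) ^ (1 / (2 * (d : ℝ))) < ((3 * T : ℕ) : ℝ) ^ (1 / (2 * (d : ℝ))) := by
    refine Real.rpow_lt_rpow hT0.le ?_ (by positivity)
    push_cast
    linarith
  unfold accuracyBound
  gcongr

theorem theorem1 (d : ℕ) (hd : 1 ≤ d) (a : (Fin d → ℕ) → ℝ) (ha : ∃ k, a k ≠ 0)
    (g : (Fin d → ℝ) → ℝ)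
    (habs : ∀ x : Fin d → ℝ, (∀ i, x i ∈ Set.Icc (-1 : ℝ) 1) →
      Summable fun k : Fin d → ℕ => |a k * ∏ i, x i ^ k i|)
    (hg : ∀ x : Fin d → ℝ, (∀ i, x i ∈ Set.Icc (-1 : ℝ) 1) →
      HasSum (fun k : Fin d → ℕ => a k * ∏ i, x i ^ k i) (g x))
    (T : ℕ) (hT : 1 ≤ T) (q : ℕ) (hq : 1 ≤ q) (δ : ℝ) (hδ : 0 < δ) :
    -- a single encoder
    (∃ fL : (Fin d → ℝ) → ℝ, IsScalarReLUNet (d + 4) d T fL ∧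
      ∀ x : Fin d → ℝ, (∀ i, x i ∈ Set.Icc (-1 + δ) (1 - δ)) →
        |fL x - g x| < accuracyBound a δ T) ∧
    -- the structured form reaches the accuracy with `3 * T` in place of `T`
    (∃ (fL : (Fin d → ℝ) → ℝ) (fV : (Fin d → ℝ) → (Fin q → ℝ)) (hL : (Fin q → ℝ) → ℝ),
      IsScalarReLUNet (d + 4) d T fL ∧ IsReLUNet (d + 4) d q T fV ∧
      IsScalarReLUNet (d + 4) q T hL ∧
      ∀ x : Fin d → ℝ, (∀ i, x i ∈ Set.Icc (-1 + δ) (1 - δ)) →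
        |fL x + hL (fV x) - g x| < accuracyBound a δ (3 * T)) ∧
    -- the second accuracy is strictly better than the first
    accuracyBound a δ (3 * T) < accuracyBound a δ T ∧
    -- every single encoder is itself of the structured form
    (∀ f : (Fin d → ℝ) → ℝ, IsScalarReLUNet (d + 4) d T f →
      ∃ (fL : (Fin d → ℝ) → ℝ) (fV : (Fin d → ℝ) → (Fin q → ℝ)) (hL : (Fin q → ℝ) → ℝ),
        IsScalarReLUNet (d + 4) d T fL ∧ IsReLUNet (d + 4) d q T fV ∧
        IsScalarReLUNet (d + 4) q T hL ∧ ∀ x, fL x + hL (fV x) = f x) := by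
  have hsum : Summable fun k => |a k| := by
    simpa using habs (fun _ => 1) fun _ => ⟨by norm_num, le_rfl⟩
  have hA : 0 < ∑' k, |a k| := by
    obtain ⟨k, hk⟩ := ha
    exact hsum.tsum_pos (fun _ => abs_nonneg _) k (abs_pos.2 hk)
  have hlt := accuracyBound_three_mul_lt hd hA hT hδ
  obtain ⟨f, hf, hfx⟩ := exists_net_lt_accuracyBound hd hsum hA hg hT hδ
  refine ⟨⟨f, hf, fun x hx => (hfx x hx).trans hlt⟩,
    ⟨f, fun _ _ => 0, fun _ => 0, hf, isReLUNet_zero _ _ _ hT, isReLUNet_zero _ _ _ hT,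
      fun x hx => by simpa using hfx x hx⟩, hlt,
    fun f hf => ⟨f, fun _ _ => 0, fun _ => 0, hf, isReLUNet_zero _ _ _ hT,
      isReLUNet_zero _ _ _ hT, fun x => add_zero _⟩⟩
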